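/- For $a\in(-\infty,1)$ let $\mathcal{A}_a$ be the family of probability distributions on $[a,1]$, and let $\mathcal{A}=\mathcal{A}_{-\infty}$ be the family of probability distributions on $(-\infty,1]$. Write $\mathrm{E}_F$ for the expectation under $X\sim F$, and $\mathrm{E}(F)=\mathrm{E}_F[X]\in[-\infty,1]$. For $\mu\in\mathbb{R}$ and a family $\mathcal{F}$ put $$D_{\inf}(F,\mu;\mathcal{F})=\inf_{G\in\mathcal{F}:\,\mathrm{E}(G)>\mu}D(F\Vert G)\in[0,\infty],$$ where $D(\cdot\Vert\cdot)$ is the Kullback–Leibler divergence and $\inf\emptyset=\infty$. Let $a\in[-\infty,1)$, let $F\in\mathcal{A}_a$ have a moment generating function $\mathrm{E}_F[e^{\lambda X}]$ that is finite in some neighborhood of $\lambda=0$, and let $\mu\in\mathbb{R}$. Then: (i) $D_{\inf}(F,\mu;\mathcal{A}_a)=D_{\inf}(F,\mu;\mathcal{A})$. (ii) If $\mu<1$, then $$D_{\inf}(F,\mu;\mathcal{A})=\max_{0\le\nu\le\frac{1}{1-\mu}}\mathrm{E}_F\bigl[\log(1-(X-\mu)\nu)\bigr],$$ where $\log 0=-\infty$,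 the expectation takes values in $[-\infty,\infty)$, and the maximum is attained. Both (i) and (ii) also hold if $\mathcal{A}_a$ and $\mathcal{A}$ are replaced by their subfamilies of distributions whose moment generating function is finite in some neighborhood of the origin. -/

import Mathlib

namespace SemiBounded

open MeasureTheory ProbabilityTheory InformationTheory
open scoped ENNReal

noncomputable section

/-- The extended expectation `E_F[u(X)] = E_F[u(X)⁺] - E_F[u(X)⁻]` of an extended-real valued
function. It is the usual expectation in `[-∞, ∞]` as soon as one of the two parts is finite;
this is so wherever it is used below. -/
def expect (F : Measure ℝ) (u : ℝ → EReal) : EReal :=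
  ((∫⁻ x, (u x).toENNReal ∂F : ℝ≥0∞) : EReal) - ((∫⁻ x, (-u x).toENNReal ∂F : ℝ≥0∞) : EReal)

/-- The mean `E(F) = E_F[X]`; it is `-∞` for a distribution on `(-∞, 1]` with a non-integrable
lower tail. -/
def mean (F : Measure ℝ) : EReal := expect F (fun x => (x : EReal))

/-- The probability distributions on `[a, 1]` for finite `a`, and on `(-∞, 1]` for `a = ⊥`. -/
def distrib (a : EReal) : Set (Measure ℝ) :=
  {F | IsProbabilityMeasure F ∧ ∀ᵐ x : ℝ ∂F, a ≤ (x : EReal) ∧ x ≤ 1}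

/-- The distributions whose moment generating function `λ ↦ E_F[exp (λ X)]` is finite in some
neighborhood of the origin. -/
def finiteMGF : Set (Measure ℝ) :=
  {F | (0 : ℝ) ∈ interior (integrableExpSet (fun x : ℝ => x) F)}

/-- `D_inf(F, μ; 𝓕)`, the infimum of the Kullback-Leibler divergence `D(F ‖ G)` over `G ∈ 𝓕`
with `E(G) > μ` (`∞` if there is no such `G`). -/
def Dinf (F : Measure ℝ) (μ : ℝ) (𝓕 : Set (Measure ℝ)) : ℝ≥0∞ :=
  ⨅ G ∈ {G | G ∈ 𝓕 ∧ (μ : EReal) < mean G}, klDiv F G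

/-- The dual objective `L(ν; F, μ) = E_F[log (1 - (X - μ) ν)]`, with `log 0 = -∞`. -/
def dualObj (F : Measure ℝ) (μ ν : ℝ) : EReal :=
  expect F (fun x => ENNReal.log (ENNReal.ofReal (1 - (x - μ) * ν)))

end

end SemiBounded

namespace SemiBounded

open MeasureTheory ProbabilityTheory InformationTheory Filter Topology
open scoped ENNReal

/-! ### Extended expectations and the mean constraint -/

section Expect

/-! The proof is Lagrangian duality with an explicit primal near-optimiser. Write `h = affine μ ν`.
For `0 ≤ ν ≤ 1/(1-μ)` it is nonnegative on `(-∞, 1]`, and `E(G) > μ` gives `E_G[h] ≤ 1`, hence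
`E_F[log h] ≤ D(F ‖ G)` (`dualObj_le_klDiv`).

Conversely, suppose `E_F[1/h] ≤ 1` and `E_F[(1-X)/h] ≤ 1-μ`. Give `G` the density `s/h` with respect
to `F`, for some `s < 1`, and put the missing mass at `1`. Then `E(G) > μ` and `D(F ‖ G) ≤ E_F[log
h] - log s`; letting `s → 1` closes the gap (`Dinf_le_dualObj`). Such a `ν` exists
(`exists_multiplier`): it is `0`, the right endpoint, or a stationary point of the dual objective.

This `G` charges only the support of `F` and the point `1`, and its density is at most `1` below
`μ`. So it stays in `[a, 1]` and keeps a finite moment generating function. It therefore lies in the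
smallest family, while the lower bound holds on the largest: all four families share one value. For
`μ ≥ 1` no `G` is admissible and every value is `∞`. -/

lemma expect_congr_ae {F : Measure ℝ} {u v : ℝ → EReal} (h : ∀ᵐ x ∂F, u x = v x) :
    expect F u = expect F v := by
  unfold expect
  congr 2 <;> exact lintegral_congr_ae (h.mono fun x hx => by simp only [hx])

lemma expect_coe_of_integrable {F : Measure ℝ} {f : ℝ → ℝ} (hf : Integrable f F) :
    expect F (fun x => (f x : EReal)) = ((∫ x, f x ∂F : ℝ) : EReal) := by
  have h1 : ∫⁻ x, ENNReal.ofReal (f x) ∂F ≠ ∞ := hf.lintegral_lt_top.ne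
  have h2 : ∫⁻ x, ENNReal.ofReal (-f x) ∂F ≠ ∞ := hf.neg.lintegral_lt_top.ne
  rw [integral_eq_lintegral_pos_part_sub_lintegral_neg_part hf, EReal.coe_sub,
    EReal.coe_ennreal_toReal h1, EReal.coe_ennreal_toReal h2]
  simp only [expect, ← EReal.coe_neg, EReal.real_coe_toENNReal]

lemma expect_eq_bot {F : Measure ℝ} {u : ℝ → EReal}
    (h : ∫⁻ x, (-u x).toENNReal ∂F = ∞) : expect F u = ⊥ := by
  simp [expect, h]

/-- For a distribution on `(-∞, 1]`, the condition on the mean can be read off from `E[1 - X]`. -/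
lemma lt_mean_iff {G : Measure ℝ} [IsProbabilityMeasure G] (hG : ∀ᵐ x ∂G, x ≤ 1) (μ : ℝ) :
    (μ : EReal) < mean G ↔ ∫⁻ x, ENNReal.ofReal (1 - x) ∂G < ENNReal.ofReal (1 - μ) := by
  by_cases hfin : ∫⁻ x, ENNReal.ofReal (1 - x) ∂G = ∞
  · have hbot : mean G = ⊥ := by
      refine expect_eq_bot ?_
      by_contra hne
      have hle : ∫⁻ x, ENNReal.ofReal (1 - x) ∂G ≤
          ∫⁻ x, 1 + (-(x : EReal)).toENNReal ∂G := by
        refine lintegral_mono fun x => ?_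
        rw [← EReal.coe_neg, EReal.real_coe_toENNReal, sub_eq_add_neg]
        exact ENNReal.ofReal_add_le.trans (by simp)
      rw [hfin, lintegral_add_left measurable_const] at hle
      refine hne ?_
      simpa using hle
    simp [hbot, hfin]
  · have hnn : 0 ≤ᵐ[G] fun x => 1 - x := hG.mono fun x hx => by simpa using hx
    have hint : Integrable (fun x : ℝ => 1 - x) G :=
      (lintegral_ofReal_ne_top_iff_integrable (by fun_prop) hnn).1 hfin
    have hid : Integrable (fun x : ℝ => x) G := by
      refine ((integrable_const (1 : ℝ)).sub hint).congr (Eventually.of_forall fun x => ?_)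
      simp
    rw [mean, expect_coe_of_integrable hid, EReal.coe_lt_coe_iff,
      ← ofReal_integral_eq_lintegral_ofReal hint hnn, integral_sub (integrable_const _) hid,
      ENNReal.ofReal_lt_ofReal_iff']
    -- Comparing the truncated values also requires `0 < 1 - μ`, which follows from `μ < E(G) ≤ 1`.
    have h1 : 0 ≤ ∫ x, (1 - x) ∂G := integral_nonneg_of_ae hnn
    rw [integral_sub (integrable_const _) hid] at h1
    simp only [integral_const, probReal_univ, smul_eq_mul, mul_one] at h1 ⊢
    constructor
    · intro h
      constructor <;> linarith
    · rintro ⟨h, -⟩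
      linarith

end Expect

/-! ### Upper and lower bounds on the divergence -/

section KL

variable {α : Type*} {mα : MeasurableSpace α} {F G : Measure α}

/-- If `G` dominates `h⁻¹ • F`, then `D(F ‖ G) ≤ E_F[log h]`. -/
lemma klDiv_le_of_withDensity_le [IsProbabilityMeasure F] [IsProbabilityMeasure G] {h : α → ℝ}
    (hm : Measurable h) (hpos : ∀ᵐ x ∂F, 0 < h x) (hint : Integrable (fun x => Real.log (h x)) F)
    (hle : F.withDensity (fun x => ENNReal.ofReal (h x)⁻¹) ≤ G) :
    klDiv F G ≤ ENNReal.ofReal (∫ x, Real.log (h x) ∂F) := by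
  have hac : F ≪ G := by
    refine (withDensity_absolutelyContinuous' (by fun_prop) ?_).trans
      (Measure.absolutelyContinuous_of_le hle)
    exact hpos.mono fun x hx => by simpa using hx
  -- Domination on every set becomes the pointwise bound `dF/dG ≤ h` wherever `dF/dG ≠ 0`.
  have hr : ∀ᵐ x ∂G, F.rnDeriv G x * ENNReal.ofReal (h x)⁻¹ ≤ 1 := by
    refine ae_le_of_forall_setLIntegral_le_of_sigmaFinite (by fun_prop) fun s hs _ => ?_
    have := hle s
    rw [withDensity_apply _ hs] at this
    rw [setLIntegral_rnDeriv_mul hac (by fun_prop) hs]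
    simpa using this
  have hposG : ∀ᵐ x ∂G, F.rnDeriv G x ≠ 0 → 0 < h x := by
    have := hpos
    rw [← Measure.withDensity_rnDeriv_eq F G hac,
      ae_withDensity_iff (Measure.measurable_rnDeriv _ _)] at this
    exact this
  have hG1 : Integrable (fun x => (F.rnDeriv G x).toReal) G := Measure.integrable_toReal_rnDeriv
  have hG2 : Integrable (fun x => (F.rnDeriv G x).toReal * Real.log (h x)) G :=
    (integrable_rnDeriv_smul_iff hac).2 hint
  -- With `r = dF/dG`, `klFun r = r log r + 1 - r` and `r ≤ h`. The term `1 - r` has `G`-integral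
  -- zero, so integrating leaves `E_F[log h]`.
  have key : ∀ᵐ x ∂G, klFun (F.rnDeriv G x).toReal ≤
      (F.rnDeriv G x).toReal * Real.log (h x) + (1 - (F.rnDeriv G x).toReal) := by
    filter_upwards [hr, hposG, Measure.rnDeriv_ne_top F G] with x h1 h2 h3
    rw [klFun_apply, add_sub_assoc]
    gcongr ?_ + _
    rcases eq_or_ne (F.rnDeriv G x) 0 with h0 | h0
    · simp [h0]
    have hh := h2 h0
    have hrp : 0 < (F.rnDeriv G x).toReal := ENNReal.toReal_pos h0 h3
    refine mul_le_mul_of_nonneg_left (Real.log_le_log hrp ?_) hrp.le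
    rw [← ENNReal.ofReal_toReal h3, ← ENNReal.ofReal_mul hrp.le, ENNReal.ofReal_le_one,
      mul_inv_le_iff₀ hh] at h1
    simpa using h1
  have hnn : 0 ≤ᵐ[G] fun x =>
      (F.rnDeriv G x).toReal * Real.log (h x) + (1 - (F.rnDeriv G x).toReal) :=
    key.mono fun x hx => (klFun_nonneg ENNReal.toReal_nonneg).trans hx
  rw [klDiv_eq_lintegral_klFun_of_ac hac]
  calc ∫⁻ x, ENNReal.ofReal (klFun (F.rnDeriv G x).toReal) ∂G
      ≤ ∫⁻ x, ENNReal.ofReal ((F.rnDeriv G x).toReal * Real.log (h x)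
          + (1 - (F.rnDeriv G x).toReal)) ∂G :=
        lintegral_mono_ae (key.mono fun x hx => ENNReal.ofReal_le_ofReal hx)
    _ = ENNReal.ofReal (∫ x, Real.log (h x) ∂F) := by
        have hG3 : Integrable (fun x => 1 - (F.rnDeriv G x).toReal) G :=
          (integrable_const (1 : ℝ)).sub hG1
        rw [← ofReal_integral_eq_lintegral_ofReal (hG2.fun_add hG3) hnn, integral_add hG2 hG3,
          integral_sub (integrable_const (1 : ℝ)) hG1, Measure.integral_toReal_rnDeriv hac,
          integral_toReal_rnDeriv_mul hac]
        simp

/-- The variational lower bound `E_F[log h] ≤ D(F ‖ G)` whenever `E_G[h] ≤ 1`. -/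
lemma integral_log_le_klDiv [IsProbabilityMeasure F] [IsProbabilityMeasure G] {h : α → ℝ}
    (hm : Measurable h) (hpos : ∀ᵐ x ∂F, 0 < h x) (hint : Integrable (fun x => Real.log (h x)) F)
    (hle : ∫⁻ x, ENNReal.ofReal (h x) ∂G ≤ 1) :
    ENNReal.ofReal (∫ x, Real.log (h x) ∂F) ≤ klDiv F G := by
  by_cases htop : klDiv F G = ∞
  · simp [htop]
  obtain ⟨hac, hllr⟩ := klDiv_ne_top_iff.1 htop
  have hrpos : ∀ᵐ x ∂F, 0 < F.rnDeriv G x := Measure.rnDeriv_pos hac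
  have hrtop : ∀ᵐ x ∂F, F.rnDeriv G x ≠ ∞ := hac.ae_le (Measure.rnDeriv_ne_top F G)
  -- By change of measure `E_F[q] ≤ E_G[h] ≤ 1`, and `log q = log h - log (dF/dG)`. The claim then
  -- follows from `log q ≤ q - 1`.
  set q : α → ℝ := fun x => h x / (F.rnDeriv G x).toReal with hq
  have hqm : Measurable q := by fun_prop
  have hqnn : 0 ≤ᵐ[F] q := hpos.mono fun x hx => div_nonneg hx.le ENNReal.toReal_nonneg
  have hqle : ∫⁻ x, ENNReal.ofReal (q x) ∂F ≤ 1 := by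
    rw [← lintegral_rnDeriv_mul hac (by fun_prop)]
    refine le_trans (lintegral_mono_ae ?_) hle
    filter_upwards [Measure.rnDeriv_ne_top F G] with x hx
    rcases eq_or_ne (F.rnDeriv G x) 0 with h0 | h0
    · simp [h0]
    have hrp : 0 < (F.rnDeriv G x).toReal := ENNReal.toReal_pos h0 hx
    conv_lhs => rw [← ENNReal.ofReal_toReal hx]
    rw [← ENNReal.ofReal_mul hrp.le, hq]
    simp only
    rw [mul_div_cancel₀ _ hrp.ne']
  have hqint : Integrable q F :=
    (lintegral_ofReal_ne_top_iff_integrable hqm.aestronglyMeasurable hqnn).1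
      (hqle.trans_lt ENNReal.one_lt_top).ne
  have hq1 : ∫ x, q x ∂F ≤ 1 := by
    rw [← ofReal_integral_eq_lintegral_ofReal hqint hqnn, ENNReal.ofReal_le_one] at hqle
    exact hqle
  have key : ∫ x, Real.log (h x) - llr F G x ∂F ≤ ∫ x, q x - 1 ∂F := by
    refine integral_mono_ae (hint.sub hllr) (hqint.sub (integrable_const _)) ?_
    filter_upwards [hpos, hrpos, hrtop] with x h1 h2 h3
    have hrp : 0 < (F.rnDeriv G x).toReal := ENNReal.toReal_pos h2.ne' h3
    simp only [llr_def]
    rw [← Real.log_div h1.ne' hrp.ne']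
    exact Real.log_le_sub_one_of_pos (div_pos h1 hrp)
  rw [integral_sub hint hllr, integral_sub hqint (integrable_const _)] at key
  rw [klDiv_of_ac_of_integrable hac hllr]
  refine ENNReal.ofReal_le_ofReal ?_
  simp only [integral_const, probReal_univ, smul_eq_mul, mul_one] at key ⊢
  linarith

end KL

/-- The affine function `1 - (x - μ) ν` whose logarithm is integrated in the dual objective; its
inverse is the density of the optimal distribution. -/
def affine (μ ν x : ℝ) : ℝ := 1 - (x - μ) * ν

@[fun_prop]
lemma measurable_affine (μ ν : ℝ) : Measurable (affine μ ν) := by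
  unfold affine; fun_prop

/-! ### The affine function, weak duality and tails -/

section Affine

variable {μ ν x : ℝ}

lemma slope_mul_le_one (hμ : μ < 1) (hν : ν ∈ Set.Icc 0 (1 / (1 - μ))) : ν * (1 - μ) ≤ 1 :=
  (le_div_iff₀ (sub_pos.2 hμ)).1 hν.2

lemma affine_eq (μ ν x : ℝ) : affine μ ν x = (1 - ν * (1 - μ)) + ν * (1 - x) := by
  unfold affine; ring

lemma one_le_affine (hν : 0 ≤ ν) (hx : x ≤ μ) : 1 ≤ affine μ ν x := by
  unfold affine
  nlinarith

end Affine

lemma integrable_affine {F : Measure ℝ} [IsFiniteMeasure F] (hF : Integrable (fun x : ℝ => x) F)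
    (μ ν : ℝ) : Integrable (affine μ ν) F :=
  (integrable_const 1).sub ((hF.sub (integrable_const μ)).mul_const ν)

lemma dualObj_eq_integral {F : Measure ℝ} {μ ν : ℝ} (hpos : ∀ᵐ x ∂F, 0 < affine μ ν x)
    (hint : Integrable (fun x => Real.log (affine μ ν x)) F) :
    dualObj F μ ν = ((∫ x, Real.log (affine μ ν x) ∂F : ℝ) : EReal) := by
  rw [← expect_coe_of_integrable hint]
  exact expect_congr_ae (hpos.mono fun x hx => ENNReal.log_ofReal_of_pos hx)

/-- A measurable function with integrable upper bound has an integrable logarithm as soon as the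
negative part of the logarithm is integrable. -/
lemma integrable_log_of_lintegral_ne_top {α : Type*} {mα : MeasurableSpace α} {F : Measure α}
    {h : α → ℝ} (hm : Measurable h) (hpos : ∀ᵐ x ∂F, 0 < h x) (hint : Integrable h F)
    (hneg : ∫⁻ x, ENNReal.ofReal (-Real.log (h x)) ∂F ≠ ∞) :
    Integrable (fun x => Real.log (h x)) F := by
  have hsub : Integrable (fun x => h x - Real.log (h x)) F := by
    refine (lintegral_ofReal_ne_top_iff_integrable (by fun_prop) ?_).1 ?_
    · filter_upwards [hpos] with x hx
      have := Real.log_le_sub_one_of_pos hx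
      simp only [Pi.zero_apply]
      linarith
    · refine ne_top_of_le_ne_top (ENNReal.add_ne_top.2 ⟨hint.lintegral_lt_top.ne, hneg⟩) ?_
      rw [← lintegral_add_left (by fun_prop)]
      refine lintegral_mono fun x => ?_
      rw [sub_eq_add_neg]
      exact ENNReal.ofReal_add_le
  refine (hint.sub hsub).congr (Eventually.of_forall fun x => ?_)
  simp

/-- Weak duality. -/
lemma dualObj_le_klDiv {F G : Measure ℝ} [IsProbabilityMeasure F] [IsProbabilityMeasure G]
    (hF : Integrable (fun x : ℝ => x) F) (hG1 : ∀ᵐ x ∂G, x ≤ 1)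
    {μ ν : ℝ} (hμ : μ < 1) (hν : ν ∈ Set.Icc 0 (1 / (1 - μ))) (hG : (μ : EReal) < mean G) :
    dualObj F μ ν ≤ (klDiv F G : EReal) := by
  by_cases hb : ∫⁻ x, (-ENNReal.log (ENNReal.ofReal (affine μ ν x))).toENNReal ∂F = ∞
  · exact (show dualObj F μ ν = ⊥ from expect_eq_bot hb).trans_le bot_le
  -- Where `affine` is nonpositive the extended logarithm is `-∞`, so a finite negative part
  -- excludes this. `Real.log` alone would not detect it, since `Real.log 0 = 0`.
  have hpos : ∀ᵐ x ∂F, 0 < affine μ ν x := by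
    have hmeas : Measurable fun x =>
        (-ENNReal.log (ENNReal.ofReal (affine μ ν x))).toENNReal := by fun_prop
    filter_upwards [ae_lt_top hmeas hb] with x hx
    by_contra hle
    simp [ENNReal.ofReal_of_nonpos (not_lt.1 hle)] at hx
  have hneg : ∫⁻ x, ENNReal.ofReal (-Real.log (affine μ ν x)) ∂F ≠ ∞ := by
    rwa [lintegral_congr_ae (g := fun x =>
      (-ENNReal.log (ENNReal.ofReal (affine μ ν x))).toENNReal)]
    filter_upwards [hpos] with x hx
    rw [ENNReal.log_ofReal_of_pos hx, ← EReal.coe_neg, EReal.real_coe_toENNReal]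
  have hint := integrable_log_of_lintegral_ne_top (measurable_affine μ ν) hpos
    (integrable_affine hF μ ν) hneg
  -- The constraint on `ν` makes `affine` a combination of `1` and `1 - x` with nonnegative
  -- coefficients, so the bound on `E_G[1 - X]` applies term by term.
  have hle : ∫⁻ x, ENNReal.ofReal (affine μ ν x) ∂G ≤ 1 := by
    have hc := sub_nonneg.2 (slope_mul_le_one hμ hν)
    calc ∫⁻ x, ENNReal.ofReal (affine μ ν x) ∂G
        = ∫⁻ x, ENNReal.ofReal (1 - ν * (1 - μ))
            + ENNReal.ofReal ν * ENNReal.ofReal (1 - x) ∂G := by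
          refine lintegral_congr_ae (hG1.mono fun x hx => ?_)
          simp only
          rw [affine_eq, ENNReal.ofReal_add hc (mul_nonneg hν.1 (sub_nonneg.2 hx)),
            ENNReal.ofReal_mul hν.1]
      _ = ENNReal.ofReal (1 - ν * (1 - μ))
            + ENNReal.ofReal ν * ∫⁻ x, ENNReal.ofReal (1 - x) ∂G := by
          rw [lintegral_add_left measurable_const, lintegral_const_mul _ (by fun_prop)]
          simp
      _ ≤ ENNReal.ofReal (1 - ν * (1 - μ)) + ENNReal.ofReal ν * ENNReal.ofReal (1 - μ) := by
          gcongr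
          exact ((lt_mean_iff hG1 μ).1 hG).le
      _ = 1 := by
          rw [← ENNReal.ofReal_mul hν.1,
            ← ENNReal.ofReal_add hc (mul_nonneg hν.1 (sub_nonneg.2 hμ.le))]
          simp
  rw [dualObj_eq_integral hpos hint]
  refine le_trans ?_ (EReal.coe_ennreal_le_coe_ennreal_iff.2
    (integral_log_le_klDiv (measurable_affine μ ν) hpos hint hle))
  rw [EReal.coe_ennreal_ofReal]
  exact_mod_cast le_max_left _ _

/-- The moment generating function near `0` only depends on the lower tail of a distribution on
`(-∞, 1]`. -/
lemma integrableExpSet_subset_of_restrict_Iic_le {F G : Measure ℝ} [IsFiniteMeasure G]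
    (hG : ∀ᵐ x ∂G, x ≤ 1) {μ : ℝ} (hle : G.restrict (Set.Iic μ) ≤ F) :
    integrableExpSet (fun x : ℝ => x) F ⊆ integrableExpSet (fun x : ℝ => x) G := by
  intro t ht
  have ht' : Integrable (fun x : ℝ => Real.exp (t * x)) F := ht
  change Integrable (fun x : ℝ => Real.exp (t * x)) G
  rw [← integrableOn_univ, ← Set.Iic_union_Ioi (a := μ)]
  refine IntegrableOn.union (ht'.mono_measure hle) ?_
  refine Integrable.of_bound (by fun_prop) (Real.exp (|t| * max |μ| 1)) ?_
  filter_upwards [ae_restrict_of_ae hG, ae_restrict_mem measurableSet_Ioi] with x hx1 hx2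
  rw [Real.norm_eq_abs, Real.abs_exp, Real.exp_le_exp]
  refine (le_abs_self _).trans ?_
  rw [abs_mul]
  refine mul_le_mul_of_nonneg_left (abs_le.2 ⟨?_, hx1.trans (le_max_right _ _)⟩) (abs_nonneg t)
  have h1 := le_max_left |μ| 1
  have h2 := neg_abs_le μ
  have h3 : μ < x := hx2
  linarith

/-! ### The near-optimal alternative and strong duality -/

section Primal

variable {F : Measure ℝ} {μ ν : ℝ}

/-- The inverse of `0` is `∞` in `ℝ≥0∞`, so a finite integral leaves no mass where `affine` is
nonpositive. -/
lemma ae_affine_pos (h1 : ∫⁻ x, (ENNReal.ofReal (affine μ ν x))⁻¹ ∂F ≤ 1) :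
    ∀ᵐ x ∂F, 0 < affine μ ν x := by
  filter_upwards [ae_lt_top (by fun_prop) (h1.trans_lt ENNReal.one_lt_top).ne] with x hx
  by_contra hle
  simp [ENNReal.ofReal_of_nonpos (not_lt.1 hle)] at hx

lemma lintegral_inv_affine (hpos : ∀ᵐ x ∂F, 0 < affine μ ν x) :
    ∫⁻ x, ENNReal.ofReal (affine μ ν x)⁻¹ ∂F = ∫⁻ x, (ENNReal.ofReal (affine μ ν x))⁻¹ ∂F :=
  lintegral_congr_ae (hpos.mono fun _ hx => ENNReal.ofReal_inv_of_pos hx)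

/-- The negative part is controlled by `-log y ≤ 1/y - 1`, the positive part by the integrability of
`affine` itself. -/
lemma integrable_log_affine [IsProbabilityMeasure F] (hF : Integrable (fun x : ℝ => x) F)
    (h1 : ∫⁻ x, (ENNReal.ofReal (affine μ ν x))⁻¹ ∂F ≤ 1) :
    Integrable (fun x => Real.log (affine μ ν x)) F := by
  have hpos := ae_affine_pos h1
  refine integrable_log_of_lintegral_ne_top (measurable_affine μ ν) hpos
    (integrable_affine hF μ ν) (ne_top_of_le_ne_top ENNReal.one_ne_top (le_trans ?_ h1))
  rw [← lintegral_inv_affine hpos]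
  refine lintegral_mono_ae (hpos.mono fun x hx => ENNReal.ofReal_le_ofReal ?_)
  have := Real.log_le_sub_one_of_pos (inv_pos.2 hx)
  rw [Real.log_inv] at this
  linarith

/-- Integrate `log y ≥ 1 - 1/y`. This ensures that `ENNReal.ofReal` truncates nothing when the
divergence bound is compared with the dual value. -/
lemma integral_log_affine_nonneg [IsProbabilityMeasure F] (hF : Integrable (fun x : ℝ => x) F)
    (h1 : ∫⁻ x, (ENNReal.ofReal (affine μ ν x))⁻¹ ∂F ≤ 1) :
    0 ≤ ∫ x, Real.log (affine μ ν x) ∂F := by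
  have hpos := ae_affine_pos h1
  have hlog := integrable_log_affine hF h1
  rw [← lintegral_inv_affine hpos] at h1
  have hnn : 0 ≤ᵐ[F] fun x => (affine μ ν x)⁻¹ := hpos.mono fun x hx => (inv_pos.2 hx).le
  have hinv : Integrable (fun x => (affine μ ν x)⁻¹) F :=
    (lintegral_ofReal_ne_top_iff_integrable (by fun_prop) hnn).1
      (h1.trans_lt ENNReal.one_lt_top).ne
  rw [← ofReal_integral_eq_lintegral_ofReal hinv hnn, ENNReal.ofReal_le_one] at h1
  have key : ∫ x, 1 - (affine μ ν x)⁻¹ ∂F ≤ ∫ x, Real.log (affine μ ν x) ∂F :=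
    integral_mono_ae ((integrable_const _).sub hinv) hlog
      (hpos.mono fun x hx => Real.one_sub_inv_le_log_of_pos hx)
  rw [integral_sub (integrable_const _) hinv] at key
  simp only [integral_const, probReal_univ, smul_eq_mul, mul_one] at key
  linarith

/-- The near-optimal alternative: the density `s / (1 - (x - μ) ν)` with respect to `F`, completed
by an atom at `1`. -/
noncomputable def alternative (F : Measure ℝ) (μ ν s : ℝ) : Measure ℝ :=
  F.withDensity (fun x => ENNReal.ofReal (affine μ ν x / s)⁻¹) +
    (1 - ∫⁻ x, ENNReal.ofReal (affine μ ν x / s)⁻¹ ∂F) • Measure.dirac 1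

lemma lintegral_inv_affine_div (hpos : ∀ᵐ x ∂F, 0 < affine μ ν x) {s : ℝ} (hs : 0 < s)
    {f : ℝ → ℝ≥0∞} (hf : Measurable f) :
    ∫⁻ x, ENNReal.ofReal (affine μ ν x / s)⁻¹ * f x ∂F =
      ENNReal.ofReal s * ∫⁻ x, f x * (ENNReal.ofReal (affine μ ν x))⁻¹ ∂F := by
  rw [← lintegral_const_mul _ (by fun_prop)]
  refine lintegral_congr_ae (hpos.mono fun x hx => ?_)
  simp only
  rw [inv_div, div_eq_mul_inv, ENNReal.ofReal_mul hs.le, ENNReal.ofReal_inv_of_pos hx]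
  ring

lemma lintegral_inv_affine_div_le_one (h1 : ∫⁻ x, (ENNReal.ofReal (affine μ ν x))⁻¹ ∂F ≤ 1)
    {s : ℝ} (hs : s ∈ Set.Ioo (0 : ℝ) 1) :
    ∫⁻ x, ENNReal.ofReal (affine μ ν x / s)⁻¹ ∂F ≤ 1 := by
  have := lintegral_inv_affine_div (ae_affine_pos h1) hs.1 (f := fun _ => 1) measurable_const
  simp only [mul_one, one_mul] at this
  rw [this]
  exact mul_le_one' (ENNReal.ofReal_le_one.2 hs.2.le) h1

lemma isProbabilityMeasure_alternative
    (h1 : ∫⁻ x, (ENNReal.ofReal (affine μ ν x))⁻¹ ∂F ≤ 1) {s : ℝ} (hs : s ∈ Set.Ioo (0 : ℝ) 1) :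
    IsProbabilityMeasure (alternative F μ ν s) where
  measure_univ := by
    rw [alternative, Measure.add_apply, withDensity_apply _ MeasurableSet.univ,
      Measure.restrict_univ, Measure.smul_apply, measure_univ, smul_eq_mul, mul_one,
      add_tsub_cancel_of_le (lintegral_inv_affine_div_le_one h1 hs)]

lemma ae_alternative {p : ℝ → Prop} (hF : ∀ᵐ x ∂F, p x) (h : p 1) (s : ℝ) :
    ∀ᵐ x ∂(alternative F μ ν s), p x := by
  rw [alternative, ae_add_measure_iff]
  refine ⟨(withDensity_absolutelyContinuous _ _).ae_le hF, Measure.ae_smul_measure ?_ _⟩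
  rw [ae_dirac_eq]
  exact h

lemma alternative_mem_distrib {a : EReal} (ha : a < 1) (hF : F ∈ distrib a)
    (h1 : ∫⁻ x, (ENNReal.ofReal (affine μ ν x))⁻¹ ∂F ≤ 1) {s : ℝ} (hs : s ∈ Set.Ioo (0 : ℝ) 1) :
    alternative F μ ν s ∈ distrib a :=
  ⟨isProbabilityMeasure_alternative h1 hs,
    ae_alternative hF.2 ⟨by exact_mod_cast ha.le, le_rfl⟩ s⟩

lemma alternative_mem_finiteMGF (hF : ∀ᵐ x ∂F, x ≤ 1) (hF' : F ∈ finiteMGF)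
    (hμ : μ < 1) (hν : 0 ≤ ν) (h1 : ∫⁻ x, (ENNReal.ofReal (affine μ ν x))⁻¹ ∂F ≤ 1)
    {s : ℝ} (hs : s ∈ Set.Ioo (0 : ℝ) 1) : alternative F μ ν s ∈ finiteMGF := by
  have := isProbabilityMeasure_alternative h1 hs
  refine interior_mono (integrableExpSet_subset_of_restrict_Iic_le (μ := μ)
    (ae_alternative hF le_rfl s) ?_) hF'
  have hd : (Measure.dirac (1 : ℝ)).restrict (Set.Iic μ) = 0 := by
    rw [Measure.restrict_eq_zero, Measure.dirac_apply' _ measurableSet_Iic]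
    simp [hμ]
  rw [alternative, Measure.restrict_add, Measure.restrict_smul, hd, smul_zero, add_zero,
    restrict_withDensity measurableSet_Iic]
  refine le_trans ?_ (Measure.restrict_le_self (s := Set.Iic μ))
  calc (F.restrict (Set.Iic μ)).withDensity (fun x => ENNReal.ofReal (affine μ ν x / s)⁻¹)
      ≤ (F.restrict (Set.Iic μ)).withDensity 1 := by
        refine withDensity_mono ?_
        filter_upwards [ae_restrict_mem measurableSet_Iic] with x hx
        -- Below `μ` the density `s / affine` is at most `s < 1`, so the lower tail is no heavier
        -- than that of `F`.
        have h2 : 1 ≤ affine μ ν x := one_le_affine hν hx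
        rw [Pi.one_apply, ENNReal.ofReal_le_one]
        refine inv_le_one_of_one_le₀ ?_
        rw [le_div_iff₀ hs.1]
        linarith [hs.2]
    _ = F.restrict (Set.Iic μ) := withDensity_one

/-- The atom at `1` contributes nothing to `E[1 - X]`, so the factor `s < 1` turns the weak bound
`h2` into the strict mean constraint. -/
lemma lt_mean_alternative (hF : ∀ᵐ x ∂F, x ≤ 1) (hμ : μ < 1)
    (h1 : ∫⁻ x, (ENNReal.ofReal (affine μ ν x))⁻¹ ∂F ≤ 1)
    (h2 : ∫⁻ x, ENNReal.ofReal (1 - x) * (ENNReal.ofReal (affine μ ν x))⁻¹ ∂F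
      ≤ ENNReal.ofReal (1 - μ)) {s : ℝ} (hs : s ∈ Set.Ioo (0 : ℝ) 1) :
    (μ : EReal) < mean (alternative F μ ν s) := by
  have := isProbabilityMeasure_alternative h1 hs
  have hle : ∀ᵐ x ∂(alternative F μ ν s), x ≤ 1 := ae_alternative hF le_rfl s
  have hm : Measurable fun x : ℝ => ENNReal.ofReal (1 - x) := by fun_prop
  rw [lt_mean_iff hle, alternative, lintegral_add_measure, lintegral_smul_measure,
    lintegral_dirac' _ hm, lintegral_withDensity_eq_lintegral_mul _ (by fun_prop) hm]
  simp only [Pi.mul_apply, sub_self, ENNReal.ofReal_zero, smul_zero, add_zero]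
  rw [lintegral_inv_affine_div (ae_affine_pos h1) hs.1 hm]
  calc _ ≤ ENNReal.ofReal s * ENNReal.ofReal (1 - μ) := by gcongr
    _ = ENNReal.ofReal (s * (1 - μ)) := (ENNReal.ofReal_mul hs.1.le).symm
    _ < ENNReal.ofReal (1 - μ) := by
      rw [ENNReal.ofReal_lt_ofReal_iff (sub_pos.2 hμ)]
      nlinarith [hs.2]

lemma klDiv_alternative_le [IsProbabilityMeasure F] (hF : Integrable (fun x : ℝ => x) F)
    (h1 : ∫⁻ x, (ENNReal.ofReal (affine μ ν x))⁻¹ ∂F ≤ 1) {s : ℝ} (hs : s ∈ Set.Ioo (0 : ℝ) 1) :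
    klDiv F (alternative F μ ν s) ≤
      ENNReal.ofReal (∫ x, Real.log (affine μ ν x) ∂F - Real.log s) := by
  have := isProbabilityMeasure_alternative h1 hs
  have hpos := ae_affine_pos h1
  have hlog := integrable_log_affine hF h1
  have heq : (fun x => Real.log (affine μ ν x / s)) =ᵐ[F]
      fun x => Real.log (affine μ ν x) - Real.log s :=
    hpos.mono fun x hx => Real.log_div hx.ne' hs.1.ne'
  refine (klDiv_le_of_withDensity_le (G := alternative F μ ν s) (h := fun x => affine μ ν x / s)
    (by fun_prop) (hpos.mono fun x hx => div_pos hx hs.1)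
    ((hlog.sub (integrable_const _)).congr heq.symm) (Measure.le_add_right le_rfl)).trans ?_
  rw [integral_congr_ae heq, integral_sub hlog (integrable_const _)]
  simp

/-- Strong duality, given a dual multiplier satisfying the optimality conditions. -/
lemma Dinf_le_dualObj {a : EReal} (ha : a < 1) (hF : F ∈ distrib a) (hF' : F ∈ finiteMGF)
    (hμ : μ < 1) (hν : 0 ≤ ν) (h1 : ∫⁻ x, (ENNReal.ofReal (affine μ ν x))⁻¹ ∂F ≤ 1)
    (h2 : ∫⁻ x, ENNReal.ofReal (1 - x) * (ENNReal.ofReal (affine μ ν x))⁻¹ ∂F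
      ≤ ENNReal.ofReal (1 - μ)) :
    (Dinf F μ (distrib a ∩ finiteMGF) : EReal) ≤ dualObj F μ ν := by
  have := hF.1
  have hle1 : ∀ᵐ x ∂F, x ≤ 1 := hF.2.mono fun x hx => hx.2
  have hid : Integrable (fun x : ℝ => x) F := integrable_of_mem_interior_integrableExpSet hF'
  have hs : ∀ s ∈ Set.Ioo (0 : ℝ) 1, Dinf F μ (distrib a ∩ finiteMGF) ≤
      ENNReal.ofReal (∫ x, Real.log (affine μ ν x) ∂F - Real.log s) := fun s hs =>
    (iInf₂_le (alternative F μ ν s)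
      ⟨⟨alternative_mem_distrib ha hF h1 hs, alternative_mem_finiteMGF hle1 hF' hμ hν h1 hs⟩,
        lt_mean_alternative hle1 hμ h1 h2 hs⟩).trans (klDiv_alternative_le hid h1 hs)
  have hlim : Tendsto
      (fun s => ENNReal.ofReal (∫ x, Real.log (affine μ ν x) ∂F - Real.log s)) (𝓝[<] 1)
      (𝓝 (ENNReal.ofReal (∫ x, Real.log (affine μ ν x) ∂F))) := by
    have hc : Tendsto (fun s => ∫ x, Real.log (affine μ ν x) ∂F - Real.log s) (𝓝[<] 1)
        (𝓝 (∫ x, Real.log (affine μ ν x) ∂F - Real.log 1)) :=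
      tendsto_const_nhds.sub ((Real.continuousAt_log one_ne_zero).tendsto.mono_left
        nhdsWithin_le_nhds)
    rw [Real.log_one, sub_zero] at hc
    exact (ENNReal.continuous_ofReal.tendsto _).comp hc
  have hfin : Dinf F μ (distrib a ∩ finiteMGF) ≤
      ENNReal.ofReal (∫ x, Real.log (affine μ ν x) ∂F) :=
    ge_of_tendsto hlim (mem_of_superset (Ioo_mem_nhdsLT zero_lt_one) hs)
  rw [dualObj_eq_integral (ae_affine_pos h1) (integrable_log_affine hid h1)]
  refine (EReal.coe_ennreal_le_coe_ennreal_iff.2 hfin).trans ?_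
  rw [EReal.coe_ennreal_ofReal, max_eq_left (integral_log_affine_nonneg hid h1)]

end Primal

/-! ### Existence of the dual multiplier -/

section Multiplier

variable {F : Measure ℝ} {μ : ℝ}

/-- If `E_F[1 / (1 - (X - μ) ν)]` exceeds `1` at the right endpoint, then it does so at an
interior point. -/
lemma exists_one_lt_lintegral_inv_affine (hμ : μ < 1)
    (h : 1 < ∫⁻ x, (ENNReal.ofReal (affine μ (1 / (1 - μ)) x))⁻¹ ∂F) :
    ∃ ν ∈ Set.Ico 0 (1 / (1 - μ)), 1 < ∫⁻ x, (ENNReal.ofReal (affine μ ν x))⁻¹ ∂F := by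
  by_contra! hcon
  refine h.not_ge ?_
  have hpos : 0 < 1 / (1 - μ) := one_div_pos.2 (sub_pos.2 hμ)
  -- The integrands converge pointwise as `ν` increases to the endpoint, so by Fatou a bound by `1`
  -- inside would persist at the endpoint.
  have hlim : ∀ x, liminf (fun ν => (ENNReal.ofReal (affine μ ν x))⁻¹) (𝓝[<] (1 / (1 - μ))) =
      (ENNReal.ofReal (affine μ (1 / (1 - μ)) x))⁻¹ := by
    intro x
    have hc : Continuous fun ν => (ENNReal.ofReal (affine μ ν x))⁻¹ :=
      (ENNReal.continuous_ofReal.comp (by unfold affine; fun_prop)).inv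
    exact ((hc.tendsto _).mono_left nhdsWithin_le_nhds).liminf_eq
  calc ∫⁻ x, (ENNReal.ofReal (affine μ (1 / (1 - μ)) x))⁻¹ ∂F
      = ∫⁻ x, liminf (fun ν => (ENNReal.ofReal (affine μ ν x))⁻¹) (𝓝[<] (1 / (1 - μ))) ∂F := by
        simp only [hlim]
    _ ≤ liminf (fun ν => ∫⁻ x, (ENNReal.ofReal (affine μ ν x))⁻¹ ∂F) (𝓝[<] (1 / (1 - μ))) :=
        lintegral_liminf_le fun ν => by fun_prop
    _ ≤ liminf (fun _ => (1 : ℝ≥0∞)) (𝓝[<] (1 / (1 - μ))) := by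
        refine liminf_le_liminf ?_
        filter_upwards [Ico_mem_nhdsLT hpos] with ν hν using hcon ν hν
    _ = 1 := liminf_const _

/-- Existence of a dual multiplier satisfying the optimality conditions. -/
lemma exists_multiplier [IsProbabilityMeasure F] (hle : ∀ᵐ x ∂F, x ≤ 1)
    (hid : Integrable (fun x : ℝ => x) F) (hμ : μ < 1) :
    ∃ ν ∈ Set.Icc 0 (1 / (1 - μ)), ∫⁻ x, (ENNReal.ofReal (affine μ ν x))⁻¹ ∂F ≤ 1 ∧
      ∫⁻ x, ENNReal.ofReal (1 - x) * (ENNReal.ofReal (affine μ ν x))⁻¹ ∂F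
        ≤ ENNReal.ofReal (1 - μ) := by
  have hμ' : 0 < 1 - μ := sub_pos.2 hμ
  rcases le_or_gt μ (∫ x, x ∂F) with hmean | hmean
  · refine ⟨0, ⟨le_rfl, (one_div_pos.2 hμ').le⟩, by simp [affine], ?_⟩
    have hint : Integrable (fun x : ℝ => 1 - x) F := (integrable_const _).sub hid
    have hnn : 0 ≤ᵐ[F] fun x => 1 - x := hle.mono fun x hx => sub_nonneg.2 hx
    simp only [affine, mul_zero, sub_zero, ENNReal.ofReal_one, inv_one, mul_one]
    rw [← ofReal_integral_eq_lintegral_ofReal hint hnn, integral_sub (integrable_const _) hid]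
    refine ENNReal.ofReal_le_ofReal ?_
    simp only [integral_const, probReal_univ, smul_eq_mul, mul_one]
    linarith
  rcases le_or_gt (∫⁻ x, (ENNReal.ofReal (affine μ (1 / (1 - μ)) x))⁻¹ ∂F) 1 with hend | hend
  · refine ⟨_, Set.right_mem_Icc.2 (one_div_pos.2 hμ').le, hend, ?_⟩
    -- At the endpoint `affine` equals `(1 - x) / (1 - μ)`, so the integrand is `1 - μ` wherever
    -- `affine` is positive.
    have hbound : ∀ᵐ x ∂F, ENNReal.ofReal (1 - x) *
        (ENNReal.ofReal (affine μ (1 / (1 - μ)) x))⁻¹ ≤ ENNReal.ofReal (1 - μ) := by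
      filter_upwards [ae_affine_pos hend] with x hx
      rw [← ENNReal.ofReal_inv_of_pos hx, ← ENNReal.ofReal_mul' (inv_pos.2 hx).le]
      refine ENNReal.ofReal_le_ofReal (le_of_eq ?_)
      rw [mul_inv_eq_iff_eq_mul₀ hx.ne']
      unfold affine
      field_simp
      ring
    exact (lintegral_mono_ae hbound).trans (by simp)
  obtain ⟨ν₁, hν₁, hgt⟩ := exists_one_lt_lintegral_inv_affine hμ hend
  have hν₁' : ν₁ * (1 - μ) < 1 := (lt_div_iff₀ hμ').1 hν₁.2
  -- Stopping at `ν₁`, short of the endpoint, keeps `affine` above `c > 0` uniformly in `ν ≤ ν₁` and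
  -- `x ≤ 1`, which provides all dominations below.
  set c := 1 - ν₁ * (1 - μ)
  have hcpos : 0 < c := sub_pos.2 hν₁'
  have hc_le : ∀ ν ∈ Set.Icc 0 ν₁, ∀ x ≤ 1, c ≤ affine μ ν x := fun ν hν x hx => by
    have h1 := mul_nonneg hν.1 (sub_nonneg.2 hx)
    have h2 := mul_le_mul_of_nonneg_right hν.2 hμ'.le
    rw [affine_eq]; linarith
  have hbd : ∀ ν ∈ Set.Icc 0 ν₁, ∀ᵐ x ∂F, c ≤ affine μ ν x := fun ν hν => hle.mono (hc_le ν hν)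
  have hid' : Integrable (fun x : ℝ => x - μ) F := hid.sub (integrable_const _)
  -- Formally, `-ψ` is the derivative of the dual objective. Since `E_F[1/affine] = 1 + ν ψ(ν)`, a
  -- zero of `ψ` makes this expectation exactly `1`.
  set ψ : ℝ → ℝ := fun ν => ∫ x, (x - μ) * (affine μ ν x)⁻¹ ∂F with hψ
  have hdom : ∀ ν ∈ Set.Icc 0 ν₁, ∀ᵐ x ∂F, ‖(x - μ) * (affine μ ν x)⁻¹‖ ≤ ‖x - μ‖ * c⁻¹ :=
    fun ν hν => (hbd ν hν).mono fun x hx => by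
      rw [norm_mul, norm_inv, Real.norm_of_nonneg (hcpos.le.trans hx)]
      gcongr
  have hψint : ∀ ν ∈ Set.Icc 0 ν₁, Integrable (fun x => (x - μ) * (affine μ ν x)⁻¹) F :=
    fun ν hν => (hid'.norm.mul_const c⁻¹).mono' (by fun_prop) (hdom ν hν)
  have hinv : ∀ ν ∈ Set.Icc 0 ν₁, Integrable (fun x => (affine μ ν x)⁻¹) F := fun ν hν => by
    refine Integrable.of_bound (by fun_prop) c⁻¹ ((hbd ν hν).mono fun x hx => ?_)
    rw [norm_inv, Real.norm_of_nonneg (hcpos.le.trans hx)]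
    gcongr
  have hinv_eq : ∀ ν ∈ Set.Icc 0 ν₁, ∫ x, (affine μ ν x)⁻¹ ∂F = 1 + ψ ν * ν := fun ν hν => by
    have : ∀ᵐ x ∂F, (affine μ ν x)⁻¹ = 1 + (x - μ) * (affine μ ν x)⁻¹ * ν :=
      (hbd ν hν).mono fun x hx => by
        have hne : affine μ ν x ≠ 0 := (hcpos.trans_le hx).ne'
        field_simp
        unfold affine
        ring
    rw [integral_congr_ae this,
      integral_add (integrable_const _) ((hψint ν hν).mul_const ν), integral_mul_const]
    simp [hψ]
  have hlint : ∀ ν ∈ Set.Icc 0 ν₁, ∫⁻ x, (ENNReal.ofReal (affine μ ν x))⁻¹ ∂F =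
      ENNReal.ofReal (1 + ψ ν * ν) := fun ν hν => by
    rw [← hinv_eq ν hν, ofReal_integral_eq_lintegral_ofReal (hinv ν hν)
      ((hbd ν hν).mono fun x hx => (inv_pos.2 (hcpos.trans_le hx)).le),
      lintegral_inv_affine ((hbd ν hν).mono fun x hx => hcpos.trans_le hx)]
  have hψ0 : ψ 0 ≤ 0 := by
    simp only [hψ, affine, mul_zero, sub_zero, inv_one, mul_one]
    rw [integral_sub hid (integrable_const _)]
    simpa using hmean.le
  have hψ1 : 0 ≤ ψ ν₁ := by
    rw [hlint ν₁ (Set.right_mem_Icc.2 hν₁.1), ENNReal.one_lt_ofReal] at hgt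
    by_contra! hneg
    nlinarith [mul_nonneg (neg_nonneg.2 hneg.le) hν₁.1]
  have hψc : ContinuousOn ψ (Set.Icc 0 ν₁) := by
    refine continuousOn_of_dominated (fun ν _ => by fun_prop) hdom (hid'.norm.mul_const c⁻¹) ?_
    filter_upwards [hle] with x hx ν hν
    have hne : affine μ ν x ≠ 0 := (hcpos.trans_le (hc_le ν hν x hx)).ne'
    have hca : Continuous fun ν => affine μ ν x := by unfold affine; fun_prop
    exact (continuousAt_const.mul (hca.continuousAt.inv₀ hne)).continuousWithinAt
  obtain ⟨ν, hν, hzero⟩ := intermediate_value_Icc hν₁.1 hψc ⟨hψ0, hψ1⟩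
  refine ⟨ν, ⟨hν.1, hν.2.trans hν₁.2.le⟩, by rw [hlint ν hν, hzero]; simp, ?_⟩
  -- Splitting `1 - x = (1 - μ) - (x - μ)` gives the expectation `(1 - μ) · 1 - ψ(ν) = 1 - μ`.
  have heq : ∀ᵐ x ∂F, ENNReal.ofReal (1 - x) * (ENNReal.ofReal (affine μ ν x))⁻¹ =
      ENNReal.ofReal ((1 - μ) * (affine μ ν x)⁻¹ - (x - μ) * (affine μ ν x)⁻¹) := by
    filter_upwards [hbd ν hν] with x hx
    have hpos : 0 < affine μ ν x := hcpos.trans_le hx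
    rw [← ENNReal.ofReal_inv_of_pos hpos, ← ENNReal.ofReal_mul' (inv_pos.2 hpos).le]
    congr 1
    ring
  have hint : Integrable
      (fun x => (1 - μ) * (affine μ ν x)⁻¹ - (x - μ) * (affine μ ν x)⁻¹) F :=
    ((hinv ν hν).const_mul (1 - μ)).sub (hψint ν hν)
  rw [lintegral_congr_ae heq, ← ofReal_integral_eq_lintegral_ofReal hint,
    integral_sub ((hinv ν hν).const_mul (1 - μ)) (hψint ν hν), integral_const_mul,
    hinv_eq ν hν]
  · change ENNReal.ofReal ((1 - μ) * (1 + ψ ν * ν) - ψ ν) ≤ _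
    simp [hzero]
  · filter_upwards [hbd ν hν, hle] with x hx hx1
    rw [← sub_mul, sub_sub_sub_cancel_right]
    exact mul_nonneg (sub_nonneg.2 hx1) (inv_nonneg.2 (hcpos.le.trans hx))

end Multiplier

/-! ### Comparison of the families -/

section Families

variable {F : Measure ℝ} {μ : ℝ}

lemma distrib_anti {a b : EReal} (hab : a ≤ b) : distrib b ⊆ distrib a :=
  fun _ hG => ⟨hG.1, hG.2.mono fun _ hx => ⟨hab.trans hx.1, hx.2⟩⟩

lemma Dinf_anti {𝓕 𝓖 : Set (Measure ℝ)} (h : 𝓕 ⊆ 𝓖) : Dinf F μ 𝓖 ≤ Dinf F μ 𝓕 :=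
  biInf_mono fun _ hG => ⟨h hG.1, hG.2⟩

lemma Dinf_eq_top_of_one_le (hμ : 1 ≤ μ) {𝓕 : Set (Measure ℝ)} (h : 𝓕 ⊆ distrib ⊥) :
    Dinf F μ 𝓕 = ∞ := by
  refine iInf₂_eq_top.2 fun G hG => ?_
  have := (h hG.1).1
  have hlt := (lt_mean_iff ((h hG.1).2.mono fun x hx => hx.2) μ).1 hG.2
  rw [ENNReal.ofReal_of_nonpos (sub_nonpos.2 hμ)] at hlt
  exact absurd hlt not_lt_zero

/-- Every family between the smallest and the largest one considered has the same `D_inf`, and it is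
the value of the dual problem. -/
lemma isGreatest_dualObj {a : EReal} (ha : a < 1) (hF : F ∈ distrib a) (hF' : F ∈ finiteMGF)
    (hμ : μ < 1) {𝓕 : Set (Measure ℝ)} (h₁ : distrib a ∩ finiteMGF ⊆ 𝓕) (h₂ : 𝓕 ⊆ distrib ⊥) :
    IsGreatest (dualObj F μ '' Set.Icc 0 (1 / (1 - μ))) (Dinf F μ 𝓕 : EReal) := by
  have := hF.1
  have hid : Integrable (fun x : ℝ => x) F := integrable_of_mem_interior_integrableExpSet hF'
  have hweak : ∀ ν ∈ Set.Icc 0 (1 / (1 - μ)), dualObj F μ ν ≤ (Dinf F μ 𝓕 : EReal) := by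
    intro ν hν
    -- The infimum is taken in `ℝ≥0∞`, so the dual value is first truncated at `0`; this is harmless
    -- because a value never exceeds its truncation.
    have hinf : (dualObj F μ ν).toENNReal ≤ Dinf F μ 𝓕 := by
      refine le_iInf₂ fun G hG => ?_
      have := (h₂ hG.1).1
      have hkl := dualObj_le_klDiv hid ((h₂ hG.1).2.mono fun x hx => hx.2) hμ hν hG.2
      simpa using EReal.toENNReal_le_toENNReal hkl
    refine le_trans ?_ (EReal.coe_ennreal_le_coe_ennreal_iff.2 hinf)
    rw [EReal.coe_toENNReal_eq_max]
    exact le_max_right _ _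
  obtain ⟨ν, hν, h1, h2⟩ := exists_multiplier (hF.2.mono fun x hx => hx.2) hid hμ
  refine ⟨⟨ν, hν, (hweak ν hν).antisymm ?_⟩, ?_⟩
  · exact (EReal.coe_ennreal_le_coe_ennreal_iff.2 (Dinf_anti h₁)).trans
      (Dinf_le_dualObj ha hF hF' hμ hν.1 h1 h2)
  · rintro _ ⟨ν', hν', rfl⟩
    exact hweak ν' hν'

end Families

end SemiBounded

/-- Let `F` be a distribution on `[a, 1]`, `a ∈ [-∞, 1)`, with a moment generating function that is
finite near the origin. Both claims are made for the full families of distributions on `[a, 1]` and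
`(-∞, 1]`, and for the families of those among them that satisfy the same moment condition. -/
theorem theorem1 (a : EReal) (ha : a < 1) (F : MeasureTheory.Measure ℝ)
    (hF : F ∈ SemiBounded.distrib a) (hF' : F ∈ SemiBounded.finiteMGF) (μ : ℝ) :
    (SemiBounded.Dinf F μ (SemiBounded.distrib a) =
        SemiBounded.Dinf F μ (SemiBounded.distrib ⊥) ∧
      (μ < 1 →
        IsGreatest (SemiBounded.dualObj F μ '' Set.Icc 0 (1 / (1 - μ)))
          (SemiBounded.Dinf F μ (SemiBounded.distrib ⊥) : EReal))) ∧
    (SemiBounded.Dinf F μ (SemiBounded.distrib a ∩ SemiBounded.finiteMGF) =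
        SemiBounded.Dinf F μ (SemiBounded.distrib ⊥ ∩ SemiBounded.finiteMGF) ∧
      (μ < 1 →
        IsGreatest (SemiBounded.dualObj F μ '' Set.Icc 0 (1 / (1 - μ)))
          (SemiBounded.Dinf F μ (SemiBounded.distrib ⊥ ∩ SemiBounded.finiteMGF) : EReal))) := by
  have hsub : SemiBounded.distrib a ⊆ SemiBounded.distrib ⊥ := SemiBounded.distrib_anti bot_le
  have hsub' : SemiBounded.distrib a ∩ SemiBounded.finiteMGF ⊆
      SemiBounded.distrib ⊥ ∩ SemiBounded.finiteMGF := Set.inter_subset_inter_left _ hsub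
  have hdual := fun (hμ : μ < 1) (𝓕 : Set (MeasureTheory.Measure ℝ)) =>
    SemiBounded.isGreatest_dualObj (𝓕 := 𝓕) ha hF hF' hμ
  have heq : ∀ 𝓕 𝓖, SemiBounded.distrib a ∩ SemiBounded.finiteMGF ⊆ 𝓕 → 𝓕 ⊆ 𝓖 →
      𝓖 ⊆ SemiBounded.distrib ⊥ → SemiBounded.Dinf F μ 𝓕 = SemiBounded.Dinf F μ 𝓖 := by
    intro 𝓕 𝓖 h₁ h₂ h₃
    rcases lt_or_ge μ 1 with hμ | hμ
    · exact EReal.coe_ennreal_injective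
        ((hdual hμ 𝓕 h₁ (h₂.trans h₃)).unique (hdual hμ 𝓖 (h₁.trans h₂) h₃))
    · rw [SemiBounded.Dinf_eq_top_of_one_le hμ (h₂.trans h₃),
        SemiBounded.Dinf_eq_top_of_one_le hμ h₃]
  exact ⟨⟨heq _ _ Set.inter_subset_left hsub subset_rfl,
      fun hμ => hdual hμ _ (Set.inter_subset_left.trans hsub) subset_rfl⟩,
    ⟨heq _ _ subset_rfl hsub' Set.inter_subset_left,
      fun hμ => hdual hμ _ hsub' Set.inter_subset_left⟩⟩
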